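/- Let $M\ge 2$, $\mathcal X\subseteq\mathbb R^d$ and $\Lambda\subseteq\mathbb R^k$. Let $\{p(x,y|\theta):\theta\in\Lambda\}$ be a parametric family of joint distributions of a data point $x\in\mathcal X$ and a label $y\in\{1,\dots,M\}$, with densities with respect to (reference measure on $\mathcal X$) $\times$ (counting measure), where the reference measure is e.g. the counting or the Lebesgue measure. Let $q$ be a prior probability distribution on $\Lambda$. Let $W(y|x,\theta)=p(y|x,\theta)$ be the regression function: for every $x,\theta$ the vector $W(\cdot|x,\theta)$ is a probability vector with $p(x,y|\theta)=W(y|x,\theta)\sum_{y'}p(x,y'|\theta)$, and each $W(y|x,\cdot)$ is measurable. All random quantities are taken with $\theta\sim q$. Let $\mathcal X'\subseteq\mathcal X$. For a random function $\hat W:\mathcal X\to\mathbb R^M$ jointly distributed with $W$, and $1\le p<\infty$, put $$\mathcal L_p^{\mathcal X'}=\sup_{x\in\mathcal X'}\Big(E\Big[\sum_{y=1}^M|W(y|x,\theta)-\hat W(y|x)|^p\Big]\Big)^{1/p},\qquad \mathcal L_\infty^{\mathcal X'}=\sup_{x\in\mathcal X'}\operatorname{ess\,sup}\max_{1\le y\le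 M}|W(y|x,\theta)-\hat W(y|x)|,$$ and for $1\le p\le\infty$ let $$R_p^{\mathcal X'}(D)=\inf\{I(W;\hat W): p(\hat W|W)\text{ a conditional distribution with }\mathcal L_p^{\mathcal X'}\le D\}\in[0,\infty],$$ where $I$ is the mutual information in nats of the two random functions, with respect to the product $\sigma$-algebras on the space of functions $\mathcal X\to\mathbb R^M$. Let $S\subseteq\mathcal X'$ be an interpolation set with $|S|=d_*$; that is, $S$ is finite and the $(M-1)\times d_*$ random matrix $W(S)=(W(y|x,\theta))_{1\le y\le M-1,\,x\in S}$ has a Lebesgue density $f$ with $f\log f$ integrable, so that its differential entropy $h(W(S))=-\int f\log f$ (natural logarithm) is well defined and finite. Then, for every $D>0$, with $[a]^+=\max(a,0)$, $$R_1^{\mathcal X'}(D)\ge\Big[h(W(S))-d_*(M-1)\log\Big(\frac{2e}{M-1}D\Big)\Big]^+,$$ $$R_2^{\mathcal X'}(D)\ge\Big[h(W(S))-d_*(M-1)\log\Big(\sqrt{\frac{2\pi e}{M-1}}\,D\Big)\Big]^+,$$ $$R_\infty^{\mathcal X'}(D)\ge\Big[h(W(S))-d_*(M-1)\log(2D)\Big]^+.$$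 -/

import Mathlib

open MeasureTheory ProbabilityTheory
open scoped ENNReal

noncomputable section

/-- A parametric family `{p(x, y | θ) : θ ∈ Λ}` of joint distributions of a data point `x ∈ 𝒳` and
a label `y ∈ {1, …, M}`. The density is taken with respect to `ref × counting`; here `ref` is the
counting measure for a discrete alphabet, Lebesgue measure for a continuous one, or any other
reference measure on `𝒳`. -/
structure ParametricFamily {d k : ℕ} (𝒳 : Set (EuclideanSpace ℝ (Fin d)))
    (Λ : Set (EuclideanSpace ℝ (Fin k))) (M : ℕ) where
  ref : Measure 𝒳
  density : 𝒳 → Fin M → Λ → ℝ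
  density_nonneg : ∀ x y θ, 0 ≤ density x y θ
  measurable_density : ∀ y θ, Measurable fun x => density x y θ
  lintegral_density : ∀ θ, ∫⁻ x, ∑ y, ENNReal.ofReal (density x y θ) ∂ref = 1

namespace ParametricFamily

variable {d k M : ℕ} {𝒳 : Set (EuclideanSpace ℝ (Fin d))} {Λ : Set (EuclideanSpace ℝ (Fin k))}

/-- The marginal density `p(x | θ)` of the data point. -/
def marginal (P : ParametricFamily 𝒳 Λ M) (x : 𝒳) (θ : Λ) : ℝ := ∑ y, P.density x y θ

/-- `W x θ y = W(y | x, θ)` is the regression function (posterior) `p(y | x, θ)` of the family: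
a probability vector given by Bayes' rule wherever `p(x | θ) > 0`. At points where `p(x | θ) = 0`
any probability vector is allowed. Measurability in `θ` makes `W(y | x, θ)` a random variable
when `θ` is drawn from a prior. -/
structure IsRegressionFunction (P : ParametricFamily 𝒳 Λ M) (W : 𝒳 → Λ → Fin M → ℝ) : Prop where
  mem_stdSimplex : ∀ x θ, W x θ ∈ stdSimplex ℝ (Fin M)
  bayes : ∀ x θ y, P.density x y θ = W x θ y * P.marginal x θ
  measurable : ∀ x y, Measurable fun θ => W x θ y

end ParametricFamily

/-- `μ` has a differential entropy that is well defined and finite: it has a density `f` with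
respect to Lebesgue measure, and `f log f` is integrable. -/
def HasFiniteDiffEntropy {ι : Type*} [Fintype ι] (μ : Measure (ι → ℝ)) : Prop :=
  μ ≪ volume ∧ Integrable (fun a => Real.negMulLog (μ.rnDeriv volume a).toReal) volume

/-- The differential entropy `-∫ f log f` (in nats) of a law `μ` with Lebesgue density `f`. -/
def diffEntropy {ι : Type*} [Fintype ι] (μ : Measure (ι → ℝ)) : ℝ :=
  ∫ a, Real.negMulLog (μ.rnDeriv volume a).toReal

/-- The mutual information (in nats) of the two components of a pair with joint law `π`: the
Kullback-Leibler divergence of `π` from the product of its marginals. -/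
def mutualInformation {α β : Type*} [MeasurableSpace α] [MeasurableSpace β]
    (π : Measure (α × β)) : ℝ≥0∞ :=
  InformationTheory.klDiv π (π.fst.prod π.snd)

section RateDistortion

variable {X Θ : Type*} [MeasurableSpace Θ] {M : ℕ}

/-- The law of the random regression function `W(· | ·, θ)`, `θ ∼ q`, on the space of functions
`X → ℝ^M` with the product `σ`-algebra. -/
def regressionLaw (q : Measure Θ) (W : X → Θ → Fin M → ℝ) : Measure (X → Fin M → ℝ) :=
  q.map fun θ x => W x θ

/-- The law of the `(M - 1) × |S|` random matrix `W(S)` with entries `W(y | x, θ)`, `y < M`,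
`x ∈ S`, where `θ ∼ q`. -/
def sampleLaw (q : Measure Θ) (W : X → Θ → Fin M → ℝ) (S : Finset X) :
    Measure (Fin (M - 1) × S → ℝ) :=
  q.map fun θ i => W i.2 θ (Fin.castLE (Nat.sub_le M 1) i.1)

/-- `S` is an interpolation set: `h(W(S))` is well defined and finite. -/
def IsInterpolationSet (q : Measure Θ) (W : X → Θ → Fin M → ℝ) (S : Finset X) : Prop :=
  HasFiniteDiffEntropy (sampleLaw q W S)

/-- The `X'`-Bayes risk for the `L_p` loss when the pair `(W, Ŵ)` has joint law `π`:
`sup_{x ∈ X'} (E ∑_y |W(y|x) - Ŵ(y|x)|^p)^{1/p}`, which for `p = ∞` reads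
`sup_{x ∈ X'} ess sup max_y |W(y|x) - Ŵ(y|x)|`. -/
def worstCaseBayesRisk (p : ℝ≥0∞) (X' : Set X) (π : Measure ((X → Fin M → ℝ) × (X → Fin M → ℝ))) :
    ℝ≥0∞ :=
  ⨆ x ∈ X',
    if p = ∞ then essSup (fun w => ⨆ y, ‖w.1 x y - w.2 x y‖ₑ) π
    else (∫⁻ w, ∑ y, ‖w.1 x y - w.2 x y‖ₑ ^ p.toReal ∂π) ^ (1 / p.toReal)

/-- The rate-distortion function `R_p^{X'}(D)`: the infimum of `I(W; Ŵ)` over all conditional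
distributions `κ = p(Ŵ | W)` for which the `X'`-Bayes risk is at most `D`. It is `∞` if there
are none. -/
def rateDistortion (p : ℝ≥0∞) (q : Measure Θ) (W : X → Θ → Fin M → ℝ) (X' : Set X) (D : ℝ) :
    ℝ≥0∞ :=
  ⨅ (κ : Kernel (X → Fin M → ℝ) (X → Fin M → ℝ)) (_ : IsMarkovKernel κ)
    (_ : worstCaseBayesRisk p X' (regressionLaw q W ⊗ₘ κ) ≤ ENNReal.ofReal D),
    mutualInformation (regressionLaw q W ⊗ₘ κ)

end RateDistortion

end

-- This is Shannon's lower bound, obtained by testing relative entropy rather than by manipulating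
-- conditional entropies, so no joint or conditional density is needed. Put `A = W(S)`, `B = Ŵ(S)`,
-- let `f` be the density of `A` and `φ` a probability density. Under the product of the marginals,
-- `φ(A - B) / f(A)` has expectation at most 1: for fixed `B` the factor `f` cancels, and Lebesgue
-- measure is translation invariant. Gibbs' principle (`ofReal_integral_le_klDiv`) then gives `I(W;
-- Ŵ) ≥ h(A) + E log φ(A - B)`.
--
-- For `φ` take a product of Laplace, Gaussian or uniform densities, the maximum-entropy laws for
-- the three losses. The log-density is then affine in the loss (constant on the support in the
-- uniform case), so the risk bound at each point of `S` controls its expectation. Optimising the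
-- scale gives the stated constants.

-- Variational bounds for relative entropy and mutual information.

/-- Gibbs' variational principle, lower bound: if `∫ h ∂ρ ≤ 1` and `h = exp g` almost surely, then
the integral of `g` is at most the relative entropy. -/
theorem ofReal_integral_le_klDiv {α : Type*} [MeasurableSpace α] {π ρ : Measure α}
    [IsProbabilityMeasure π] [IsProbabilityMeasure ρ] {h : α → ℝ≥0∞} {g : α → ℝ}
    (hh : Measurable h) (hρ : ∫⁻ a, h a ∂ρ ≤ 1) (hg : Integrable g π)
    (hgh : ∀ᵐ a ∂π, h a = ENNReal.ofReal (Real.exp (g a))) :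
    ENNReal.ofReal (∫ a, g a ∂π) ≤ InformationTheory.klDiv π ρ := by
  by_cases hac : π ≪ ρ
  swap
  · simp [InformationTheory.klDiv_of_not_ac hac]
  by_cases hint : Integrable (llr π ρ) π
  swap
  · simp [InformationTheory.klDiv_of_not_integrable hint]
  rw [InformationTheory.klDiv_of_ac_of_integrable hac hint]
  simp only [probReal_univ, add_sub_cancel_right]
  apply ENNReal.ofReal_le_ofReal
  -- Changing measure from `π` to `ρ` cancels the derivative `dπ/dρ`. Only `≤` survives, since `h`
  -- may have mass where that derivative vanishes.
  have hF : ∫⁻ a, ENNReal.ofReal (Real.exp (g a - llr π ρ a)) ∂π ≤ 1 := by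
    calc ∫⁻ a, ENNReal.ofReal (Real.exp (g a - llr π ρ a)) ∂π
        = ∫⁻ a, h a * (π.rnDeriv ρ a)⁻¹ ∂π := by
          apply lintegral_congr_ae
          filter_upwards [hgh, Measure.rnDeriv_pos hac, hac.ae_le (Measure.rnDeriv_lt_top π ρ)]
            with a ha hpos hlt
          have hr := ENNReal.toReal_pos hpos.ne' hlt.ne
          rw [ha, Real.exp_sub, llr, Real.exp_log hr, ENNReal.ofReal_div_of_pos hr,
            ENNReal.ofReal_toReal hlt.ne, div_eq_mul_inv]
      _ = ∫⁻ a, π.rnDeriv ρ a * (h a * (π.rnDeriv ρ a)⁻¹) ∂ρ :=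
          (lintegral_rnDeriv_mul hac
            (hh.mul (Measure.measurable_rnDeriv π ρ).inv).aemeasurable).symm
      _ ≤ ∫⁻ a, h a ∂ρ := by
          apply lintegral_mono
          intro a
          dsimp only
          rw [mul_left_comm]
          exact mul_le_of_le_one_right' (ENNReal.mul_inv_le_one _)
      _ ≤ 1 := hρ
  have hFint : Integrable (fun a => Real.exp (g a - llr π ρ a)) π :=
    ⟨Real.continuous_exp.comp_aestronglyMeasurable (hg.sub hint).1, by
      rw [hasFiniteIntegral_iff_ofReal (ae_of_all _ fun _ => (Real.exp_pos _).le)]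
      exact hF.trans_lt ENNReal.one_lt_top⟩
  have hF' : ∫ a, Real.exp (g a - llr π ρ a) ∂π ≤ 1 := by
    rw [integral_eq_lintegral_of_nonneg_ae (ae_of_all _ fun _ => (Real.exp_pos _).le) hFint.1]
    exact ENNReal.toReal_le_of_le_ofReal zero_le_one (by simpa using hF)
  -- The pointwise bound `t ≤ exp t - 1` takes the place of Jensen's inequality.
  have hle : ∫ a, (g a - llr π ρ a) ∂π ≤ ∫ a, (Real.exp (g a - llr π ρ a) - 1) ∂π :=
    integral_mono (hg.sub hint) (hFint.sub (integrable_const 1)) fun a => by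
      dsimp only
      linarith [Real.add_one_le_exp (g a - llr π ρ a)]
  rw [integral_sub hg hint, integral_sub hFint (integrable_const 1)] at hle
  simp only [integral_const, probReal_univ, smul_eq_mul, mul_one] at hle
  linarith

theorem integrable_log_rnDeriv {ι : Type*} [Fintype ι] {μ : Measure (ι → ℝ)}
    [IsProbabilityMeasure μ] (hμ : HasFiniteDiffEntropy μ) :
    Integrable (fun a => Real.log (μ.rnDeriv volume a).toReal) μ := by
  rw [← integrable_rnDeriv_smul_iff hμ.1]
  refine hμ.2.neg.congr (ae_of_all _ fun a => ?_)
  simp [Real.negMulLog]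

theorem integral_log_rnDeriv {ι : Type*} [Fintype ι] {μ : Measure (ι → ℝ)}
    [IsProbabilityMeasure μ] (hμ : HasFiniteDiffEntropy μ) :
    ∫ a, Real.log (μ.rnDeriv volume a).toReal ∂μ = -diffEntropy μ := by
  rw [← integral_rnDeriv_smul hμ.1, diffEntropy, ← integral_neg]
  simp [Real.negMulLog]

/-- Shannon's lower bound in variational form: a subprobability density `φ = exp ℓ` bounds the
mutual information below by `h(A) + E ℓ(A - B)`. -/
theorem diffEntropy_add_integral_le_mutualInformation {ι α β : Type*} [Fintype ι]
    [MeasurableSpace α] [MeasurableSpace β] {π : Measure (α × β)} [IsProbabilityMeasure π]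
    {A : α → ι → ℝ} {B : β → ι → ℝ} (hA : Measurable A) (hB : Measurable B)
    (hent : HasFiniteDiffEntropy (π.fst.map A))
    {φ : (ι → ℝ) → ℝ≥0∞} (hφ : Measurable φ) (hφ1 : ∫⁻ z, φ z ≤ 1) {ℓ : (ι → ℝ) → ℝ}
    (hℓ : Integrable (fun w => ℓ (A w.1 - B w.2)) π)
    (hφℓ : ∀ᵐ w ∂π, φ (A w.1 - B w.2) = ENNReal.ofReal (Real.exp (ℓ (A w.1 - B w.2)))) :
    ENNReal.ofReal (diffEntropy (π.fst.map A) + ∫ w, ℓ (A w.1 - B w.2) ∂π)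
      ≤ mutualInformation π := by
  set μ := π.fst.map A with hμ
  have : IsProbabilityMeasure μ := Measure.isProbabilityMeasure_map hA.aemeasurable
  set f := μ.rnDeriv volume with hf
  have hfm : Measurable f := Measure.measurable_rnDeriv _ _
  have hmap : π.map (fun w => A w.1) = μ := by
    rw [hμ, Measure.fst, Measure.map_map hA measurable_fst]
    rfl
  have hA1 : Measurable fun w : α × β => A w.1 := hA.comp measurable_fst
  have hmp : MeasurePreserving (fun w : α × β => A w.1) π μ := ⟨hA1, hmap⟩
  have hlog : Integrable (fun w => Real.log (f (A w.1)).toReal) π :=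
    hmp.integrable_comp_of_integrable (integrable_log_rnDeriv hent)
  have hlogI : ∫ w, Real.log (f (A w.1)).toReal ∂π = -diffEntropy μ := by
    have h := integral_map (f := fun a => Real.log (f a).toReal) hA1.aemeasurable
      (by rw [hmap]; exact (integrable_log_rnDeriv hent).1)
    rw [← h, hmap, ← integral_log_rnDeriv hent]
  have hpos : ∀ᵐ w ∂π, 0 < f (A w.1) :=
    hmp.quasiMeasurePreserving.ae (Measure.rnDeriv_pos hent.1)
  have hlt : ∀ᵐ w ∂π, f (A w.1) < ∞ :=
    hmp.quasiMeasurePreserving.ae (hent.1.ae_le (Measure.rnDeriv_lt_top μ volume))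
  have key := ofReal_integral_le_klDiv (π := π) (ρ := π.fst.prod π.snd)
    (h := fun w => φ (A w.1 - B w.2) * (f (A w.1))⁻¹)
    (g := fun w => ℓ (A w.1 - B w.2) - Real.log (f (A w.1)).toReal)
    (by fun_prop) ?_ (hℓ.sub hlog) ?_
  · rw [integral_sub hℓ hlog, hlogI, sub_neg_eq_add, add_comm] at key
    exact key
  -- With `b` outermost, the inner integral against the law of `A` is at most the Lebesgue integral
  -- of a translate of `φ`.
  · rw [lintegral_prod_symm' _ (by fun_prop)]
    calc ∫⁻ b, ∫⁻ a, φ (A a - B b) * (f (A a))⁻¹ ∂π.fst ∂π.snd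
        ≤ ∫⁻ _, 1 ∂π.snd := by
          apply lintegral_mono
          intro b
          dsimp only
          have hm : Measurable fun a => φ (a - B b) * (f a)⁻¹ := by fun_prop
          rw [← lintegral_map (μ := π.fst) (f := fun a => φ (a - B b) * (f a)⁻¹) hm hA, ← hμ,
            ← lintegral_rnDeriv_mul hent.1 hm.aemeasurable]
          refine le_trans (lintegral_mono fun a => ?_)
            ((lintegral_sub_right_eq_self φ (B b)).trans_le hφ1)
          dsimp only
          rw [mul_left_comm]
          exact mul_le_of_le_one_right' (ENNReal.mul_inv_le_one _)
      _ ≤ 1 := by simp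
  · filter_upwards [hφℓ, hpos, hlt] with w hw h0 h1
    have hr := ENNReal.toReal_pos h0.ne' h1.ne
    rw [hw, Real.exp_sub, Real.exp_log hr, ENNReal.ofReal_div_of_pos hr,
      ENNReal.ofReal_toReal h1.ne, div_eq_mul_inv]

-- Normalised product densities.

theorem lintegral_prod_ofReal_eq_one {ι : Type*} [Fintype ι] {φ : ℝ → ℝ} (h0 : ∀ t, 0 ≤ φ t)
    (h1 : ∫ t, φ t = 1) :
    ∫⁻ z : ι → ℝ, ENNReal.ofReal (∏ i, φ (z i)) = 1 := by
  -- A non-integrable function has Bochner integral 0, so the value 1 already forces integrability.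
  have hint : Integrable fun z : ι → ℝ => ∏ i, φ (z i) :=
    Integrable.fintype_prod fun _ => integrable_of_integral_eq_one h1
  rw [← ofReal_integral_eq_lintegral_ofReal hint
    (ae_of_all _ fun z => Finset.prod_nonneg fun i _ => h0 _),
    integral_fintype_prod_volume_eq_pow, h1]
  simp

theorem integral_laplace {c : ℝ} (hc : 0 < c) :
    ∫ t : ℝ, Real.exp (-(c * |t|) - Real.log (2 / c)) = 1 := by
  have h : ∀ t : ℝ, Real.exp (-(c * |t|) - Real.log (2 / c))
      = (fun s => c / 2 * Real.exp (-c * s)) |t| := fun t => by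
    simp only
    rw [Real.exp_sub, Real.exp_log (by positivity)]
    field_simp
  simp_rw [h]
  rw [integral_comp_abs (f := fun s => c / 2 * Real.exp (-c * s)), integral_const_mul,
    integral_exp_mul_Ioi (by linarith)]
  simp
  field_simp

theorem integral_gaussian_density {c : ℝ} (hc : 0 < c) :
    ∫ t : ℝ, Real.exp (-(c * |t| ^ 2) - Real.log (Real.pi / c) / 2) = 1 := by
  have hp : 0 < Real.pi / c := by positivity
  have h : ∀ t : ℝ, Real.exp (-(c * |t| ^ 2) - Real.log (Real.pi / c) / 2)
      = Real.exp (-c * t ^ 2) * (√(Real.pi / c))⁻¹ := fun t => by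
    rw [Real.exp_sub, ← Real.log_sqrt hp.le, Real.exp_log (Real.sqrt_pos.2 hp), sq_abs,
      div_eq_mul_inv, neg_mul]
  simp_rw [h]
  rw [integral_mul_const, integral_gaussian, mul_inv_cancel₀ (Real.sqrt_pos.2 hp).ne']

-- Restriction to the interpolation set.

section SampleMatrix

variable {X : Type*} {M : ℕ}

/-- The `(M - 1) × |S|` matrix of values of a function `X → ℝ^M` on `S`. -/
def sampleMatrix (S : Finset X) (w : X → Fin M → ℝ) : Fin (M - 1) × S → ℝ :=
  fun i => w i.2 (Fin.castLE (Nat.sub_le M 1) i.1)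

theorem measurable_sampleMatrix (S : Finset X) :
    Measurable (sampleMatrix S : (X → Fin M → ℝ) → _) := by
  unfold sampleMatrix
  fun_prop

variable {Θ : Type*} [MeasurableSpace Θ] {q : Measure Θ} {W : X → Θ → Fin M → ℝ}

theorem measurable_regression (hW : ∀ x y, Measurable fun θ => W x θ y) :
    Measurable fun θ x => W x θ :=
  measurable_pi_lambda _ fun x => measurable_pi_lambda _ fun y => hW x y

theorem map_sampleMatrix_regressionLaw (hW : ∀ x y, Measurable fun θ => W x θ y) (S : Finset X) :
    (regressionLaw q W).map (sampleMatrix S) = sampleLaw q W S := by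
  rw [regressionLaw, Measure.map_map (measurable_sampleMatrix S) (measurable_regression hW)]
  rfl

/-- The variational Shannon lower bound for the joint law of the regression function and its
reconstruction. -/
theorem ofReal_diffEntropy_add_integral_le [IsProbabilityMeasure q]
    (hW : ∀ x y, Measurable fun θ => W x θ y) {S : Finset X} (hS : IsInterpolationSet q W S)
    (κ : Kernel (X → Fin M → ℝ) (X → Fin M → ℝ)) [IsMarkovKernel κ]
    {φ : (Fin (M - 1) × S → ℝ) → ℝ≥0∞} (hφ : Measurable φ) (hφ1 : ∫⁻ z, φ z ≤ 1)
    {ℓ : (Fin (M - 1) × S → ℝ) → ℝ}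
    (hℓ : Integrable (fun w => ℓ (sampleMatrix S w.1 - sampleMatrix S w.2))
      (regressionLaw q W ⊗ₘ κ))
    (hφℓ : ∀ᵐ w ∂(regressionLaw q W ⊗ₘ κ), φ (sampleMatrix S w.1 - sampleMatrix S w.2)
      = ENNReal.ofReal (Real.exp (ℓ (sampleMatrix S w.1 - sampleMatrix S w.2)))) :
    ENNReal.ofReal (diffEntropy (sampleLaw q W S)
      + ∫ w, ℓ (sampleMatrix S w.1 - sampleMatrix S w.2) ∂(regressionLaw q W ⊗ₘ κ))
      ≤ mutualInformation (regressionLaw q W ⊗ₘ κ) := by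
  have : IsProbabilityMeasure (regressionLaw q W) :=
    Measure.isProbabilityMeasure_map (measurable_regression hW).aemeasurable
  have hlaw : (regressionLaw q W ⊗ₘ κ).fst.map (sampleMatrix S) = sampleLaw q W S := by
    rw [Measure.fst_compProd, map_sampleMatrix_regressionLaw hW]
  have h := diffEntropy_add_integral_le_mutualInformation (measurable_sampleMatrix S)
    (measurable_sampleMatrix S) (by rw [hlaw]; exact hS) hφ hφ1 hℓ hφℓ
  rwa [hlaw] at h

end SampleMatrix
-- From the risk constraint to rate-distortion bounds.
section LowerBounds

variable {X Θ : Type*} [MeasurableSpace Θ] {M : ℕ} {q : Measure Θ} {W : X → Θ → Fin M → ℝ}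

theorem lintegral_sum_pow_le_of_worstCaseBayesRisk_le {n : ℕ} (hn : n ≠ 0) {X' : Set X}
    {π : Measure ((X → Fin M → ℝ) × (X → Fin M → ℝ))} {r : ℝ≥0∞}
    (h : worstCaseBayesRisk n X' π ≤ r) {x : X} (hx : x ∈ X') :
    ∫⁻ w, ∑ y, ‖w.1 x y - w.2 x y‖ₑ ^ n ∂π ≤ r ^ n := by
  have hle := (le_iSup₂ (f := fun x (_ : x ∈ X') => _) x hx).trans h
  rw [if_neg (ENNReal.natCast_ne_top n), one_div, ENNReal.rpow_inv_le_iff (by simp; omega)] at hle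
  simpa using hle

theorem ae_abs_sub_le_of_worstCaseBayesRisk_le {X' : Set X}
    {π : Measure ((X → Fin M → ℝ) × (X → Fin M → ℝ))} {D : ℝ} (hD : 0 ≤ D)
    (h : worstCaseBayesRisk ∞ X' π ≤ ENNReal.ofReal D) {x : X} (hx : x ∈ X') :
    ∀ᵐ w ∂π, ∀ y, |w.1 x y - w.2 x y| ≤ D := by
  have hle := (le_iSup₂ (f := fun x (_ : x ∈ X') => _) x hx).trans h
  rw [if_pos rfl] at hle
  filter_upwards [ENNReal.ae_le_essSup fun w => ⨆ y, ‖w.1 x y - w.2 x y‖ₑ] with w hw y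
  have h1 := ((le_iSup (fun y => ‖w.1 x y - w.2 x y‖ₑ) y).trans hw).trans hle
  rwa [← ofReal_norm, ENNReal.ofReal_le_ofReal_iff hD, Real.norm_eq_abs] at h1

theorem sum_castLE_le (f : Fin M → ℝ≥0∞) :
    ∑ y : Fin (M - 1), f (Fin.castLE (Nat.sub_le M 1) y) ≤ ∑ y, f y := by
  simpa [tsum_fintype] using
    ENNReal.tsum_comp_le_tsum_of_injective (Fin.castLE_injective (Nat.sub_le M 1)) f

theorem lintegral_enorm_sum_sampleMatrix_le {n : ℕ} (hn : n ≠ 0) {X' : Set X} {S : Finset X}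
    (hSX' : (S : Set X) ⊆ X') {π : Measure ((X → Fin M → ℝ) × (X → Fin M → ℝ))} {D : ℝ}
    (hD : 0 ≤ D) (h : worstCaseBayesRisk n X' π ≤ ENNReal.ofReal D) :
    ∫⁻ w, ‖∑ i, |sampleMatrix S w.1 i - sampleMatrix S w.2 i| ^ n‖ₑ ∂π
      ≤ ENNReal.ofReal (S.card * D ^ n) := by
  calc ∫⁻ w, ‖∑ i, |sampleMatrix S w.1 i - sampleMatrix S w.2 i| ^ n‖ₑ ∂π
      ≤ ∫⁻ w, ∑ x : S, ∑ y, ‖w.1 x y - w.2 x y‖ₑ ^ n ∂π := by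
        apply lintegral_mono
        intro w
        dsimp only
        refine (enorm_sum_le _ _).trans ?_
        rw [Fintype.sum_prod_type_right]
        refine Finset.sum_le_sum fun x _ => ?_
        simp only [enorm_pow, Real.enorm_abs]
        exact sum_castLE_le fun y => ‖w.1 x y - w.2 x y‖ₑ ^ n
    _ = ∑ x : S, ∫⁻ w, ∑ y, ‖w.1 x y - w.2 x y‖ₑ ^ n ∂π :=
        lintegral_finsetSum _ fun x _ => by fun_prop
    _ ≤ ∑ _x : S, ENNReal.ofReal D ^ n :=
        Finset.sum_le_sum fun x _ =>
          lintegral_sum_pow_le_of_worstCaseBayesRisk_le hn h (hSX' x.2)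
    _ = ENNReal.ofReal (S.card * D ^ n) := by
        rw [ENNReal.ofReal_mul (by positivity), ENNReal.ofReal_pow hD]
        simp

/-- The test density is a product of copies of `exp (-c|t|^n - K)`. Dropping the last label only
lowers the loss, so its total over `S` has mean at most `|S| D^n`. The rate `c` stays free, to be
optimised later. -/
theorem ofReal_le_rateDistortion_natCast [IsProbabilityMeasure q]
    (hW : ∀ x y, Measurable fun θ => W x θ y) {X' : Set X} {S : Finset X}
    (hSX' : (S : Set X) ⊆ X') (hS : IsInterpolationSet q W S) {D : ℝ} (hD : 0 ≤ D)
    {n : ℕ} (hn : n ≠ 0) {c K : ℝ} (hc : 0 ≤ c)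
    (hdens : ∫ t : ℝ, Real.exp (-(c * |t| ^ n) - K) = 1) :
    ENNReal.ofReal (diffEntropy (sampleLaw q W S) - S.card * (c * D ^ n)
      - S.card * (M - 1 : ℕ) * K) ≤ rateDistortion n q W X' D := by
  refine le_iInf fun κ => le_iInf fun _ => le_iInf fun hκ => ?_
  have : IsProbabilityMeasure (regressionLaw q W) :=
    Measure.isProbabilityMeasure_map (measurable_regression hW).aemeasurable
  set π := regressionLaw q W ⊗ₘ κ with hπ
  set Z : (X → Fin M → ℝ) × (X → Fin M → ℝ) → ℝ :=
    fun w => ∑ i, |sampleMatrix S w.1 i - sampleMatrix S w.2 i| ^ n with hZ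
  have hZm : Measurable Z := by
    have := measurable_sampleMatrix (M := M) S
    fun_prop
  have hZle : ∫⁻ w, ‖Z w‖ₑ ∂π ≤ ENNReal.ofReal (S.card * D ^ n) :=
    lintegral_enorm_sum_sampleMatrix_le hn hSX' hD hκ
  have hZint : Integrable Z π :=
    ⟨hZm.aestronglyMeasurable, hZle.trans_lt ENNReal.ofReal_lt_top⟩
  have hZI : ∫ w, Z w ∂π ≤ S.card * D ^ n :=
    (Real.le_norm_self _).trans <| (ENNReal.ofReal_le_ofReal_iff (by positivity)).1 <| by
      rw [ofReal_norm]
      exact (enorm_integral_le_lintegral_enorm _).trans hZle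
  set ℓ : (Fin (M - 1) × S → ℝ) → ℝ := fun z => ∑ i, (-(c * |z i| ^ n) - K) with hℓ
  have hℓZ : ∀ w : (X → Fin M → ℝ) × (X → Fin M → ℝ),
      ℓ (sampleMatrix S w.1 - sampleMatrix S w.2) = -(c * Z w) - S.card * (M - 1 : ℕ) * K := by
    intro w
    simp only [hℓ, hZ, Finset.sum_sub_distrib, Finset.sum_neg_distrib, ← Finset.mul_sum,
      Pi.sub_apply, Finset.sum_const, Finset.card_univ, Fintype.card_prod, Fintype.card_fin,
      Fintype.card_coe, nsmul_eq_mul, Nat.cast_mul]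
    ring
  have key := ofReal_diffEntropy_add_integral_le hW hS κ
    (φ := fun z => ENNReal.ofReal (∏ i, Real.exp (-(c * |z i| ^ n) - K))) (by fun_prop)
    (lintegral_prod_ofReal_eq_one (fun _ => (Real.exp_pos _).le) hdens).le (ℓ := ℓ)
    (by simp_rw [hℓZ]; exact (hZint.const_mul c).neg.sub (integrable_const _))
    (ae_of_all _ fun w => by simp only [hℓ, Real.exp_sum])
  refine le_trans (ENNReal.ofReal_le_ofReal ?_) key
  have hint : Integrable (fun w => -(c * Z w)) π := (hZint.const_mul c).neg
  simp_rw [hℓZ, ← hπ]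
  rw [integral_sub hint (integrable_const _), integral_neg, integral_const_mul]
  simp only [integral_const, probReal_univ, smul_eq_mul, one_mul]
  linarith [mul_le_mul_of_nonneg_left hZI hc]

theorem integral_uniform_density {D : ℝ} (hD : 0 < D) :
    ∫ t : ℝ, (Set.Icc (-D) D).indicator (fun _ => (2 * D)⁻¹) t = 1 := by
  rw [integral_indicator_const _ measurableSet_Icc, Real.volume_real_Icc_of_le (by linarith),
    smul_eq_mul]
  field_simp
  ring

theorem ofReal_le_rateDistortion_top [IsProbabilityMeasure q]
    (hW : ∀ x y, Measurable fun θ => W x θ y) {X' : Set X} {S : Finset X}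
    (hSX' : (S : Set X) ⊆ X') (hS : IsInterpolationSet q W S) {D : ℝ} (hD : 0 < D) :
    ENNReal.ofReal (diffEntropy (sampleLaw q W S) - S.card * (M - 1 : ℕ) * Real.log (2 * D))
      ≤ rateDistortion ∞ q W X' D := by
  refine le_iInf fun κ => le_iInf fun _ => le_iInf fun hκ => ?_
  have : IsProbabilityMeasure (regressionLaw q W) :=
    Measure.isProbabilityMeasure_map (measurable_regression hW).aemeasurable
  have key := ofReal_diffEntropy_add_integral_le hW hS κ
    (φ := fun z => ENNReal.ofReal (∏ i, (Set.Icc (-D) D).indicator (fun _ => (2 * D)⁻¹) (z i)))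
    ?_ (lintegral_prod_ofReal_eq_one (Set.indicator_nonneg fun _ _ => by positivity)
      (integral_uniform_density hD)).le
    -- A constant `ℓ` suffices: the residual on `S` almost surely lies in the cube where the uniform
    -- density is constant.
    (ℓ := fun _ => -(S.card * (M - 1 : ℕ) * Real.log (2 * D))) (integrable_const _) ?_
  · simpa [sub_eq_add_neg] using key
  · have hm : Measurable ((Set.Icc (-D) D).indicator fun _ => (2 * D)⁻¹) :=
      measurable_const.indicator measurableSet_Icc
    fun_prop
  · have hae : ∀ᵐ w ∂(regressionLaw q W ⊗ₘ κ), ∀ x : S, ∀ y, |w.1 x y - w.2 x y| ≤ D :=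
      ae_all_iff.2 fun x => ae_abs_sub_le_of_worstCaseBayesRisk_le hD.le hκ (hSX' x.2)
    filter_upwards [hae] with w hw
    rw [Finset.prod_congr rfl fun i _ => Set.indicator_of_mem (Set.mem_Icc.2 (abs_le.1 ?_)) _]
    · rw [Real.exp_neg, ← Nat.cast_mul, Real.exp_nat_mul, Real.exp_log (by positivity)]
      rw [← inv_pow]
      simp [Nat.mul_comm]
    · exact hw i.2 _

end LowerBounds

theorem mainTheorem8 {d k M : ℕ} (hM : 2 ≤ M)
    (𝒳 : Set (EuclideanSpace ℝ (Fin d))) (Λ : Set (EuclideanSpace ℝ (Fin k)))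
    (P : ParametricFamily 𝒳 Λ M) (q : Measure Λ) [IsProbabilityMeasure q]
    (W : 𝒳 → Λ → Fin M → ℝ) (hW : P.IsRegressionFunction W)
    (X' : Set 𝒳) (S : Finset 𝒳) (hSX' : (S : Set 𝒳) ⊆ X') (hS : IsInterpolationSet q W S)
    (D : ℝ) (hD : 0 < D) :
    ENNReal.ofReal (max (diffEntropy (sampleLaw q W S)
        - S.card * ((M : ℝ) - 1) * Real.log (2 * Real.exp 1 / ((M : ℝ) - 1) * D)) 0)
      ≤ rateDistortion 1 q W X' D ∧
    ENNReal.ofReal (max (diffEntropy (sampleLaw q W S)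
        - S.card * ((M : ℝ) - 1)
          * Real.log (Real.sqrt (2 * Real.pi * Real.exp 1 / ((M : ℝ) - 1)) * D)) 0)
      ≤ rateDistortion 2 q W X' D ∧
    ENNReal.ofReal (max (diffEntropy (sampleLaw q W S)
        - S.card * ((M : ℝ) - 1) * Real.log (2 * D)) 0)
      ≤ rateDistortion ∞ q W X' D := by
  have hM1 : ((M - 1 : ℕ) : ℝ) = M - 1 := by
    rw [Nat.cast_sub (by omega), Nat.cast_one]
  have hm : (0 : ℝ) < M - 1 := by
    rw [← hM1]
    exact_mod_cast (by omega : 0 < M - 1)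
  set m : ℝ := (M : ℝ) - 1 with hmdef
  -- `ENNReal.ofReal` already truncates at zero.
  have hmax : ∀ a : ℝ, ENNReal.ofReal (max a 0) = ENNReal.ofReal a := fun a => by
    rw [ENNReal.ofReal_max, ENNReal.ofReal_zero, max_eq_left zero_le]
  simp_rw [hmax]
  refine ⟨?_, ?_, ?_⟩
  -- `c = m / D` minimises `c D + m log (2 / c)`; the term `c D = m` becomes the factor `e` inside
  -- the logarithm.
  · have hc : 0 < m / D := by positivity
    have h := ofReal_le_rateDistortion_natCast hW.measurable hSX' hS hD.le one_ne_zero hc.le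
      (K := Real.log (2 / (m / D))) (by simpa using integral_laplace hc)
    rw [Nat.cast_one] at h
    refine le_of_eq_of_le (congrArg _ ?_) h
    have he : 2 * Real.exp 1 / m * D = Real.exp 1 * (2 / (m / D)) := by field_simp
    rw [he, Real.log_mul (Real.exp_pos 1).ne' (by positivity), Real.log_exp, hM1]
    field_simp
    ring
  -- `c = m / (2 D²)` minimises `c D² + (m / 2) log (π / c)`; the term `c D² = m / 2` becomes the
  -- factor `√e`.
  · have hc : 0 < m / (2 * D ^ 2) := by positivity
    have h := ofReal_le_rateDistortion_natCast hW.measurable hSX' hS hD.le two_ne_zero hc.le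
      (integral_gaussian_density hc)
    rw [Nat.cast_ofNat] at h
    refine le_of_eq_of_le (congrArg _ ?_) h
    have he : √(2 * Real.pi * Real.exp 1 / m) * D
        = √(Real.exp 1 * (Real.pi / (m / (2 * D ^ 2)))) := by
      rw [show Real.exp 1 * (Real.pi / (m / (2 * D ^ 2)))
        = 2 * Real.pi * Real.exp 1 / m * D ^ 2 by field_simp, Real.sqrt_mul (by positivity),
        Real.sqrt_sq hD.le]
    rw [he, Real.log_sqrt (by positivity), Real.log_mul (Real.exp_pos 1).ne' (by positivity),
      Real.log_exp, hM1]
    field_simp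
    ring
  · have h := ofReal_le_rateDistortion_top hW.measurable hSX' hS hD
    rwa [hM1] at h
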